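/- \textbf{Definitions.} Let $(\varphi_e)_{e\in\omega}$ be a standard enumeration of the partial computable functions and, for $X\in 2^\omega$, let $(\varphi^X_e)_{e\in\omega}$ be a standard enumeration of the functions partial computable in $X$. Sets of natural numbers are identified with their characteristic sequences in $2^\omega$. A \emph{continuous semimeasure} is a function $P:2^{<\omega}\to[0,1]$ with $P(\varnothing)\le 1$ and $P(\sigma)\ge P(\sigma0)+P(\sigma1)$ for all $\sigma$; it is \emph{lower semicomputable} if each $P(\sigma)$ is the limit of a nondecreasing sequence of rationals that is computable uniformly in $\sigma$. Let $\mathbf{M}$ be a fixed universal continuous semimeasure, i.e. a lower semicomputable continuous semimeasure such that for every lower semicomputable continuous semimeasure $P$ there is a constant $c$ with $P(\sigma)\le c\,\mathbf{M}(\sigma)$ for all $\sigma$. For $S\subseteq 2^{<\omega}$ put $\mathbf{M}(S)=\sum_{\sigma\in S}\mathbf{M}(\sigma)$. A $\Pi^0_1$ class is an effectively closed set $\mathcal{P}\subseteq 2^\omega$, that is, the set of all sequences with no initial segment in some fixed c.e. set of strings. For a $\Pi^0_1$ class $\mathcal P$, let $T_n$ be the set of all strings of length $n$ that are initial segments of members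 of $\mathcal P$; $\mathcal{P}$ is \emph{deep} if there is a computable, nondecreasing, unbounded function $g:\omega\to\omega$ such that $\mathbf{M}(T_n)\le 2^{-g(n)}$ for all $n$. A set $C\subseteq\omega$ is an \emph{index set} if $e\in C$ and $\varphi_e=\varphi_i$ imply $i\in C$; it is \emph{non-trivial} if $C\ne\emptyset$ and $C\neq\omega$. \textbf{Theorem.} (i) The halting set $\emptyset'=\{e\in\omega : \varphi_e(e){\downarrow}\}$ is a member of a deep $\Pi^0_1$ class. (ii) For every $X\in2^\omega$, the jump $X'=\{e\in\omega : \varphi^X_e(e){\downarrow}\}$ is a member of a deep $\Pi^0_1$ class. (iii) Every non-trivial index set is a member of a deep $\Pi^0_1$ class. -/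

import Mathlib

namespace DeepClass

open Filter Topology

/-- The initial segment `X ↾ n` of a sequence `X : ℕ → Bool`. -/
def initSeg (X : ℕ → Bool) (n : ℕ) : List Bool := (List.range n).map X

/-- The characteristic sequence of a set of natural numbers. -/
noncomputable def charSeq (A : Set ℕ) : ℕ → Bool := by
  classical exact fun n => decide (n ∈ A)

/-! ### Continuous semimeasures -/

/-- Continuous semimeasures on `2^{<ω}`; the values automatically lie in `[0, 1]`. -/
structure IsContinuousSemimeasure (P : List Bool → ℝ) : Prop where
  nonneg : ∀ σ, 0 ≤ P σ
  root_le_one : P [] ≤ 1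
  superadditive : ∀ σ, P (σ ++ [false]) + P (σ ++ [true]) ≤ P σ

/-- Each value `f σ` is the limit of a nondecreasing sequence of (nonnegative) rationals, given by
numerators `a σ s` and denominators `b σ s + 1` that are computable uniformly in `σ` and `s`. -/
def IsLowerSemicomputable (f : List Bool → ℝ) : Prop :=
  ∃ a b : List Bool → ℕ → ℕ, Computable₂ a ∧ Computable₂ b ∧
    ∀ σ, Monotone (fun s => (a σ s : ℝ) / ((b σ s : ℝ) + 1)) ∧
      Tendsto (fun s => (a σ s : ℝ) / ((b σ s : ℝ) + 1)) atTop (𝓝 (f σ))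

/-- Universal lower semicomputable continuous semimeasures: they dominate every lower
semicomputable continuous semimeasure up to a multiplicative constant. -/
structure IsUniversalSemimeasure (M : List Bool → ℝ) : Prop where
  semimeasure : IsContinuousSemimeasure M
  lowerSemicomputable : IsLowerSemicomputable M
  dominates : ∀ P, IsContinuousSemimeasure P → IsLowerSemicomputable P →
    ∃ c : ℝ, ∀ σ, P σ ≤ c * M σ

/-! ### Existence of a universal semimeasure

The next namespace only serves to prove that universal semimeasures exist: the program with index
`e` is read as a sequence of rational lower bounds, these are completed to a semimeasure that is
frozen before its value at the root exceeds `1`, and the results are added with weights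
`2 ^ (-(e + 1))`. -/

namespace Universal
open Nat.Partrec (Code)
open Nat.Partrec.Code (evaln)

def val (e s : ℕ) (σ : List Bool) (t : ℕ) : ℕ :=
  ((evaln s (Denumerable.ofNat Code e) (Encodable.encode (σ, t))).map
    fun v => 2 ^ s * v.unpair.1 / (v.unpair.2 + 1)).getD 0

def sup (e s : ℕ) (σ : List Bool) : ℕ → ℕ
  | 0 => 0
  | t + 1 => max (sup e s σ t) (val e s σ t)

def tree (e s : ℕ) : ℕ → List Bool → ℕ
  | 0, _ => 0
  | d + 1, σ => max (sup e s σ s) (tree e s d (σ ++ [false]) + tree e s d (σ ++ [true]))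

def node (e s : ℕ) (σ : List Bool) : ℕ := tree e s (s - σ.length) σ

def stage (e : ℕ) : ℕ → ℕ
  | 0 => 0
  | s + 1 => if node e (s + 1) [] ≤ 2 ^ (s + 1) then s + 1 else stage e s

def num (σ : List Bool) (s : ℕ) : ℕ → ℕ
  | 0 => 0
  | e + 1 => num σ s e + 2 ^ (s - (e + 1)) * (2 ^ (s - stage e s) * node e (stage e s) σ)

theorem primrec_pow : Primrec₂ ((· ^ ·) : ℕ → ℕ → ℕ) :=
  Primrec₂.unpaired'.1 Nat.Primrec.pow

theorem primrec_val : Primrec fun p : (ℕ × ℕ × List Bool) × ℕ => val p.1.1 p.1.2.1 p.1.2.2 p.2 := by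
  unfold val
  have he : Primrec fun p : (ℕ × ℕ × List Bool) × ℕ => p.1.1 := Primrec.fst.comp Primrec.fst
  have hs : Primrec fun p : (ℕ × ℕ × List Bool) × ℕ => p.1.2.1 :=
    Primrec.fst.comp (Primrec.snd.comp Primrec.fst)
  have hσ : Primrec fun p : (ℕ × ℕ × List Bool) × ℕ => p.1.2.2 :=
    Primrec.snd.comp (Primrec.snd.comp Primrec.fst)
  have h1 := Nat.Partrec.Code.primrec_evaln.comp
    ((hs.pair ((Primrec.ofNat Code).comp he)).pair (Primrec.encode.comp (hσ.pair Primrec.snd)))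
  refine Primrec.option_getD.comp (Primrec.option_map h1 ?_) (Primrec.const 0)
  refine Primrec.nat_div.comp (Primrec.nat_mul.comp
    (primrec_pow.comp (Primrec.const 2) (hs.comp Primrec.fst))
    (Primrec.fst.comp (Primrec.unpair.comp Primrec.snd)))
    (Primrec.succ.comp (Primrec.snd.comp (Primrec.unpair.comp Primrec.snd)))

theorem primrec_sup : Primrec fun p : ℕ × ℕ × List Bool => sup p.1 p.2.1 p.2.2 p.2.1 := by
  refine (Primrec.nat_rec' (f := fun p : ℕ × ℕ × List Bool => p.2.1) (g := fun _ => 0)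
    (h := fun p q => max q.2 (val p.1 p.2.1 p.2.2 q.1))
    (Primrec.fst.comp Primrec.snd) (Primrec.const 0) ?_).of_eq ?_
  · exact Primrec.nat_max.comp (Primrec.snd.comp Primrec.snd)
      (primrec_val.comp (Primrec.fst.pair (Primrec.fst.comp Primrec.snd)))
  · rintro ⟨e, s, σ⟩
    have : ∀ t, Nat.rec (motive := fun _ => ℕ) 0 (fun n ih => max ih (val e s σ n)) t
        = sup e s σ t := by
      intro t; induction t with
      | zero => rfl
      | succ n ih => simp only [sup, ih]
    exact this s

theorem primrec_node : Primrec₂ fun (a : ℕ × ℕ) (σ : List Bool) => node a.1 a.2 σ := by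
  refine Primrec.nat_omega_rec _ (m := fun a σ => a.2 - σ.length)
    (l := fun a σ => if σ.length < a.2 then [σ ++ [false], σ ++ [true]] else [])
    (g := fun a p => some (if p.1.length < a.2 then
      max (sup a.1 a.2 p.1 a.2) (p.2.foldl (· + ·) 0) else 0)) ?_ ?_ ?_ ?_ ?_
  · exact Primrec.nat_sub.comp (Primrec.snd.comp Primrec.fst) (Primrec.list_length.comp Primrec.snd)
  · refine Primrec.ite (Primrec.nat_lt.comp (Primrec.list_length.comp Primrec.snd)
      (Primrec.snd.comp Primrec.fst)) ?_ (Primrec.const [])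
    refine Primrec.list_cons.comp (Primrec.list_concat.comp Primrec.snd (Primrec.const false)) ?_
    exact Primrec.list_cons.comp (Primrec.list_concat.comp Primrec.snd (Primrec.const true))
      (Primrec.const [])
  · refine Primrec.option_some.comp (Primrec.ite (Primrec.nat_lt.comp
      (Primrec.list_length.comp (Primrec.fst.comp Primrec.snd))
      (Primrec.snd.comp Primrec.fst)) ?_ (Primrec.const 0))
    refine Primrec.nat_max.comp (primrec_sup.comp ((Primrec.fst.comp Primrec.fst).pair
      ((Primrec.snd.comp Primrec.fst).pair (Primrec.fst.comp Primrec.snd)))) ?_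
    exact Primrec.list_foldl (h := fun _ q => q.1 + q.2) (Primrec.snd.comp Primrec.snd)
      (Primrec.const 0)
      (Primrec.nat_add.comp (Primrec.fst.comp Primrec.snd) (Primrec.snd.comp Primrec.snd)).to₂
  · intro a σ τ h
    split_ifs at h with hl
    · simp only [List.mem_cons, List.not_mem_nil, or_false] at h
      rcases h with rfl | rfl <;> simp only [List.length_append, List.length_cons, List.length_nil]
        <;> omega
    · simp at h
  · rintro ⟨e, s⟩ σ
    by_cases hl : σ.length < s
    · obtain ⟨d, hd⟩ : ∃ d, s - σ.length = d + 1 := ⟨s - σ.length - 1, by omega⟩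
      have h2 : s - (σ.length + 1) = d := by omega
      simp [hl, node, hd, h2, tree]
    · have : s - σ.length = 0 := by omega
      simp [hl, node, this, tree]

theorem primrec_stage : Primrec₂ stage := by
  refine (Primrec.nat_rec (f := fun _ : ℕ => 0)
    (g := fun e q => if node e (q.1 + 1) [] ≤ 2 ^ (q.1 + 1) then q.1 + 1 else q.2)
    (Primrec.const 0) ?_).of_eq ?_
  · have h1 : Primrec fun p : ℕ × ℕ × ℕ => p.2.1 + 1 :=
      Primrec.succ.comp (Primrec.fst.comp Primrec.snd)
    exact Primrec.ite (Primrec.nat_le.comp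
      (primrec_node.comp (Primrec.fst.pair h1) (Primrec.const []))
      (primrec_pow.comp (Primrec.const 2) h1)) h1 (Primrec.snd.comp Primrec.snd)
  · intro e s
    induction s with
    | zero => rfl
    | succ n ih => simp only [stage, ← ih]

theorem primrec_num : Primrec₂ fun (σ : List Bool) (s : ℕ) => num σ s s := by
  refine (Primrec.nat_rec' (f := fun p : List Bool × ℕ => p.2) (g := fun _ => 0)
    (h := fun p q => q.2 + 2 ^ (p.2 - (q.1 + 1)) *
      (2 ^ (p.2 - stage q.1 p.2) * node q.1 (stage q.1 p.2) p.1))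
    Primrec.snd (Primrec.const 0) ?_).of_eq ?_
  · have hs : Primrec fun p : (List Bool × ℕ) × ℕ × ℕ => p.1.2 := Primrec.snd.comp Primrec.fst
    have hσ : Primrec fun p : (List Bool × ℕ) × ℕ × ℕ => p.1.1 := Primrec.fst.comp Primrec.fst
    have he : Primrec fun p : (List Bool × ℕ) × ℕ × ℕ => p.2.1 := Primrec.fst.comp Primrec.snd
    have hst := primrec_stage.comp he hs
    have two := Primrec.const (α := (List Bool × ℕ) × ℕ × ℕ) 2
    exact Primrec.nat_add.comp (Primrec.snd.comp Primrec.snd)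
      (Primrec.nat_mul.comp (primrec_pow.comp two (Primrec.nat_sub.comp hs (Primrec.succ.comp he)))
        (Primrec.nat_mul.comp (primrec_pow.comp two (Primrec.nat_sub.comp hs hst))
          (primrec_node.comp (he.pair hst) hσ)))
  · rintro ⟨σ, s⟩
    have : ∀ t, Nat.rec (motive := fun _ => ℕ) 0 (fun n ih => ih + 2 ^ (s - (n + 1)) *
      (2 ^ (s - stage n s) * node n (stage n s) σ)) t = num σ s t := by
      intro t; induction t with
      | zero => rfl
      | succ n ih => simp only [num, ih]
    exact this s

theorem two_mul_val_le (e s : ℕ) (σ : List Bool) (t : ℕ) : 2 * val e s σ t ≤ val e (s + 1) σ t := by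
  unfold val
  cases h : evaln s (Denumerable.ofNat Code e) (Encodable.encode (σ, t)) with
  | none => simp
  | some v =>
    have := Nat.Partrec.Code.evaln_mono (Nat.le_succ s) h
    rw [Option.mem_def] at this
    rw [this]
    simp only [Option.map_some, Option.getD_some]
    rw [pow_succ, mul_comm (2 ^ s) 2, mul_assoc 2]
    exact Nat.mul_div_le_mul_div_assoc _ _ _

theorem two_mul_sup_le (e s : ℕ) (σ : List Bool) (t : ℕ) : 2 * sup e s σ t ≤ sup e (s + 1) σ t := by
  induction t with
  | zero => simp [sup]
  | succ t ih => have := two_mul_val_le e s σ t; simp only [sup]; omega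

theorem val_le_sup (e s : ℕ) (σ : List Bool) {t u : ℕ} (h : t < u) : val e s σ t ≤ sup e s σ u := by
  induction u with
  | zero => omega
  | succ u ih =>
    simp only [sup]
    rcases Nat.lt_succ_iff_lt_or_eq.1 h with h | rfl
    · exact (ih h).trans (le_max_left _ _)
    · exact le_max_right _ _

theorem two_mul_tree_le (e s d d' : ℕ) (h : d ≤ d') (σ : List Bool) :
    2 * tree e s d σ ≤ tree e (s + 1) d' σ := by
  induction d generalizing d' σ with
  | zero => simp [tree]
  | succ d ih =>
    obtain ⟨d', rfl⟩ : ∃ k, d' = k + 1 := ⟨d' - 1, by omega⟩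
    have h0 := ih d' (by omega) (σ ++ [false])
    have h1 := ih d' (by omega) (σ ++ [true])
    have h2 := two_mul_sup_le e s σ s
    have h3 : sup e (s + 1) σ s ≤ sup e (s + 1) σ (s + 1) := le_max_left _ _
    simp only [tree]; omega

theorem two_mul_node_le (e s : ℕ) (σ : List Bool) : 2 * node e s σ ≤ node e (s + 1) σ :=
  two_mul_tree_le e s _ _ (by omega) σ

theorem node_superadditive (e s : ℕ) (σ : List Bool) :
    node e s (σ ++ [false]) + node e s (σ ++ [true]) ≤ node e s σ := by
  unfold node
  simp only [List.length_append, List.length_cons, List.length_nil, zero_add]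
  cases h : s - σ.length with
  | zero =>
    have : s - (σ.length + 1) = 0 := by omega
    simp [this, tree]
  | succ d =>
    have : s - (σ.length + 1) = d := by omega
    rw [this]; exact le_max_right _ _

theorem node_le_root (e s : ℕ) (σ : List Bool) : node e s σ ≤ node e s [] := by
  induction σ using List.reverseRecOn with
  | nil => exact le_rfl
  | append_singleton σ b ih =>
    have := node_superadditive e s σ
    cases b <;> omega

theorem stage_le (e s : ℕ) : stage e s ≤ s := by
  induction s with
  | zero => exact le_rfl
  | succ s ih => simp only [stage]; split_ifs <;> omega

theorem stage_mono (e : ℕ) : Monotone (stage e) := by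
  refine monotone_nat_of_le_succ fun s => ?_
  have := stage_le e s
  simp only [stage]; split_ifs <;> omega

theorem root_le (e s : ℕ) : node e (stage e s) [] ≤ 2 ^ stage e s := by
  induction s with
  | zero => simp [stage, node, tree]
  | succ s ih =>
    simp only [stage]; split_ifs with h
    · exact h
    · exact ih

/-- The rational approximations attached to the program with index `e`. -/
noncomputable def app (e s : ℕ) (σ : List Bool) : ℝ := (node e s σ : ℝ) / 2 ^ s

theorem app_mono (e : ℕ) (σ : List Bool) : Monotone fun s => app e s σ := by
  refine monotone_nat_of_le_succ fun s => ?_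
  have h : (2 * node e s σ : ℝ) ≤ node e (s + 1) σ := by exact_mod_cast two_mul_node_le e s σ
  unfold app
  rw [div_le_div_iff₀ (by positivity) (by positivity), pow_succ]
  nlinarith [pow_pos (two_pos : (0 : ℝ) < 2) s]

theorem app_nonneg (e s : ℕ) (σ : List Bool) : 0 ≤ app e s σ := by unfold app; positivity

theorem app_superadditive (e s : ℕ) (σ : List Bool) :
    app e s (σ ++ [false]) + app e s (σ ++ [true]) ≤ app e s σ := by
  unfold app
  rw [← add_div]
  gcongr
  exact_mod_cast node_superadditive e s σ

theorem app_stage_le_one (e s : ℕ) (σ : List Bool) : app e (stage e s) σ ≤ 1 := by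
  unfold app
  rw [div_le_one (by positivity)]
  exact_mod_cast (node_le_root e _ σ).trans (root_le e s)

/-- The weighted sum of the approximations after `s` steps. -/
noncomputable def total (σ : List Bool) (s : ℕ) : ℝ :=
  ∑ e ∈ Finset.range s, (1 / 2 : ℝ) ^ (e + 1) * app e (stage e s) σ

theorem total_mono (σ : List Bool) : Monotone (total σ) := by
  intro s t h
  unfold total
  calc _ ≤ ∑ e ∈ Finset.range s, (1 / 2 : ℝ) ^ (e + 1) * app e (stage e t) σ := by
        gcongr with e; exact app_mono e σ (stage_mono e h)
    _ ≤ _ := Finset.sum_le_sum_of_subset_of_nonneg (by simpa using h)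
        fun e _ _ => mul_nonneg (by positivity) (app_nonneg _ _ _)

theorem total_le_one (σ : List Bool) (s : ℕ) : total σ s ≤ 1 := by
  have h : ∀ n, ∑ e ∈ Finset.range n, (1 / 2 : ℝ) ^ (e + 1) = 1 - (1 / 2) ^ n := by
    intro n; induction n with
    | zero => simp
    | succ n ih => rw [Finset.sum_range_succ, ih]; ring
  unfold total
  calc _ ≤ ∑ e ∈ Finset.range s, (1 / 2 : ℝ) ^ (e + 1) * 1 := by
        gcongr with e; exact app_stage_le_one _ _ _
    _ ≤ 1 := by
        simp only [mul_one, h]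
        have : (0 : ℝ) ≤ (1 / 2) ^ s := by positivity
        linarith

theorem total_eq (σ : List Bool) (s : ℕ) :
    total σ s = (num σ s s : ℝ) / (((4 ^ s - 1 : ℕ) : ℝ) + 1) := by
  have h4 : (((4 ^ s - 1 : ℕ) : ℝ) + 1) = 2 ^ s * 2 ^ s := by
    rw [Nat.cast_sub (Nat.one_le_pow _ _ (by norm_num))]
    push_cast
    rw [← mul_pow]; norm_num
  have key : ∀ n ≤ s, (num σ s n : ℝ) = 2 ^ s * 2 ^ s *
      ∑ e ∈ Finset.range n, (1 / 2 : ℝ) ^ (e + 1) * app e (stage e s) σ := by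
    intro n hn
    induction n with
    | zero => simp [num]
    | succ n ih =>
      rw [Finset.sum_range_succ, mul_add, ← ih (by omega)]
      simp only [num]
      push_cast
      congr 1
      have h1 : (2 : ℝ) ^ s = 2 ^ (s - (n + 1)) * 2 ^ (n + 1) := by
        rw [← pow_add]; congr 1; omega
      have h2 : (2 : ℝ) ^ s = 2 ^ (s - stage n s) * 2 ^ stage n s := by
        rw [← pow_add]; congr 1; have := stage_le n s; omega
      unfold app
      nth_rewrite 1 [h1]
      nth_rewrite 1 [h2]
      rw [one_div, inv_pow]
      field_simp
  rw [h4, key s le_rfl]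
  unfold total
  field_simp

/-- The limit of the weighted sums. -/
noncomputable def M (σ : List Bool) : ℝ := ⨆ s, total σ s

theorem bdd (σ : List Bool) : BddAbove (Set.range (total σ)) :=
  ⟨1, by rintro _ ⟨s, rfl⟩; exact total_le_one σ s⟩

theorem tendsto_total (σ : List Bool) : Tendsto (total σ) atTop (𝓝 (M σ)) :=
  tendsto_atTop_ciSup (total_mono σ) (bdd σ)

theorem total_le_M (σ : List Bool) (s : ℕ) : total σ s ≤ M σ := le_ciSup (bdd σ) s

theorem M_semimeasure : IsContinuousSemimeasure M where
  nonneg σ := by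
    have := total_le_M σ 0
    simpa [total] using this
  root_le_one := ciSup_le (total_le_one [])
  superadditive σ := by
    refine le_of_tendsto_of_tendsto' ((tendsto_total _).add (tendsto_total _)) (tendsto_total σ) ?_
    intro s
    unfold total
    rw [← Finset.sum_add_distrib]
    gcongr with e
    rw [← mul_add]
    gcongr
    exact app_superadditive _ _ _

theorem M_lowerSemicomputable : IsLowerSemicomputable M := by
  refine ⟨fun σ s => num σ s s, fun _ s => 4 ^ s - 1, primrec_num.to_comp, ?_, fun σ => ?_⟩
  · exact (Primrec.nat_sub.comp (primrec_pow.comp (Primrec.const 4) Primrec.snd)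
      (Primrec.const 1)).to_comp
  · simp only [← total_eq]
    exact ⟨total_mono σ, tendsto_total σ⟩

theorem tree_le {P : List Bool → ℝ} (hP : IsContinuousSemimeasure P) {e s : ℕ}
    (h : ∀ σ, (sup e s σ s : ℝ) ≤ 2 ^ s * P σ) (d : ℕ) (σ : List Bool) :
    (tree e s d σ : ℝ) ≤ 2 ^ s * P σ := by
  induction d generalizing σ with
  | zero => simp only [tree, Nat.cast_zero]; exact mul_nonneg (by positivity) (hP.nonneg σ)
  | succ d ih =>
    simp only [tree, Nat.cast_max, Nat.cast_add]
    refine max_le (h σ) ?_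
    calc _ ≤ 2 ^ s * P (σ ++ [false]) + 2 ^ s * P (σ ++ [true]) := add_le_add (ih _) (ih _)
      _ = 2 ^ s * (P (σ ++ [false]) + P (σ ++ [true])) := by ring
      _ ≤ _ := by gcongr; exact hP.superadditive σ

theorem M_dominates (P : List Bool → ℝ) (hP : IsContinuousSemimeasure P)
    (hl : IsLowerSemicomputable P) : ∃ c : ℝ, ∀ σ, P σ ≤ c * M σ := by
  obtain ⟨a, b, ha, hb, hab⟩ := hl
  have hle : ∀ σ t, (a σ t : ℝ) / ((b σ t : ℝ) + 1) ≤ P σ := fun σ t =>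
    (hab σ).1.ge_of_tendsto (hab σ).2 t
  obtain ⟨c, hc⟩ := Nat.Partrec.Code.exists_code.1
    (Primrec₂.natPair.to_comp.comp ha hb : Computable fun p : List Bool × ℕ => Nat.pair _ _)
  have hev : ∀ σ t, Nat.pair (a σ t) (b σ t) ∈ c.eval (Encodable.encode (σ, t)) := by
    intro σ t; rw [hc]; simp
  set e := Encodable.encode c with he
  have hce : Denumerable.ofNat Code e = c := Denumerable.ofNat_encode c
  have hnn : ∀ (s : ℕ) σ, 0 ≤ 2 ^ s * P σ := fun s σ => mul_nonneg (by positivity) (hP.nonneg σ)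
  have hval : ∀ s σ t, (val e s σ t : ℝ) ≤ 2 ^ s * P σ := by
    intro s σ t
    unfold val
    rw [hce]
    cases h : evaln s c (Encodable.encode (σ, t)) with
    | none => simpa using hnn s σ
    | some v =>
      have hv : v = Nat.pair (a σ t) (b σ t) :=
        Part.mem_unique (Nat.Partrec.Code.evaln_sound h) (hev σ t)
      subst hv
      simp only [Option.map_some, Option.getD_some, Nat.unpair_pair]
      calc _ ≤ ((2 ^ s * a σ t : ℕ) : ℝ) / ((b σ t + 1 : ℕ) : ℝ) := Nat.cast_div_le
        _ = 2 ^ s * ((a σ t : ℝ) / ((b σ t : ℝ) + 1)) := by push_cast; ring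
        _ ≤ _ := by gcongr; exact hle σ t
  have hsup : ∀ s σ t, (sup e s σ t : ℝ) ≤ 2 ^ s * P σ := by
    intro s σ t
    induction t with
    | zero => simpa [sup] using hnn s σ
    | succ t ih => simp only [sup, Nat.cast_max]; exact max_le ih (hval s σ t)
  have hnode : ∀ s σ, (node e s σ : ℝ) ≤ 2 ^ s * P σ := fun s σ =>
    tree_le hP (fun τ => hsup s τ s) _ σ
  have hstage : ∀ s, stage e s = s := by
    intro s
    cases s with
    | zero => rfl
    | succ s =>
      have : (node e (s + 1) [] : ℝ) ≤ 2 ^ (s + 1) :=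
        (hnode _ _).trans (mul_le_of_le_one_right (by positivity) hP.root_le_one)
      simp only [stage]
      rw [if_pos (by exact_mod_cast this)]
  refine ⟨2 ^ (e + 1), fun σ => ?_⟩
  refine le_of_tendsto' (hab σ).2 fun t => ?_
  obtain ⟨k, hk⟩ := Nat.Partrec.Code.evaln_complete.1 (hev σ t)
  have hlim : Tendsto (fun s : ℕ => (1 / 2 : ℝ) ^ s + 2 ^ (e + 1) * M σ) atTop
      (𝓝 (0 + 2 ^ (e + 1) * M σ)) :=
    (tendsto_pow_atTop_nhds_zero_of_lt_one (by norm_num) (by norm_num)).add_const _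
  rw [zero_add] at hlim
  refine ge_of_tendsto hlim ?_
  filter_upwards [eventually_ge_atTop (k + t + σ.length + e + 1)] with s hs
  have h1 : evaln s c (Encodable.encode (σ, t)) = some (Nat.pair (a σ t) (b σ t)) :=
    Nat.Partrec.Code.evaln_mono (by omega) hk
  have h2 : val e s σ t = 2 ^ s * a σ t / (b σ t + 1) := by
    unfold val
    rw [hce, h1]
    simp
  have h3 : val e s σ t ≤ node e s σ := by
    refine (val_le_sup e s σ (show t < s by omega)).trans ?_
    unfold node
    obtain ⟨d, hd⟩ : ∃ d, s - σ.length = d + 1 := ⟨s - σ.length - 1, by omega⟩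
    rw [hd]
    exact le_max_left _ _
  have h4 : 2 ^ s * a σ t < (node e s σ + 1) * (b σ t + 1) := by
    have := Nat.lt_succ_of_le h3
    rw [h2] at this
    exact (Nat.div_lt_iff_lt_mul (by omega)).1 this
  have h5 : (2 ^ s * a σ t : ℝ) ≤ (node e s σ + 1) * (b σ t + 1) := by exact_mod_cast h4.le
  have h6 : (1 / 2 : ℝ) ^ (e + 1) * app e s σ ≤ M σ := by
    refine le_trans ?_ (total_le_M σ s)
    have := Finset.single_le_sum (s := Finset.range s)
      (f := fun i => (1 / 2 : ℝ) ^ (i + 1) * app i (stage i s) σ)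
      (fun i _ => mul_nonneg (by positivity) (app_nonneg _ _ _))
      (Finset.mem_range.2 (show e < s by omega))
    simpa only [hstage, total] using this
  have h7 : app e s σ ≤ 2 ^ (e + 1) * M σ := by
    calc app e s σ = 2 ^ (e + 1) * ((1 / 2 : ℝ) ^ (e + 1) * app e s σ) := by
          rw [← mul_assoc, ← mul_pow]; norm_num
      _ ≤ _ := by gcongr
  refine le_trans ?_ (add_le_add_right h7 _)
  rw [div_le_iff₀ (by positivity)]
  unfold app
  rw [one_div, inv_pow, ← one_div, ← add_div, div_mul_eq_mul_div, le_div_iff₀ (by positivity)]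
  nlinarith [h5]

end Universal

theorem exists_isUniversalSemimeasure : ∃ M, IsUniversalSemimeasure M :=
  ⟨Universal.M, Universal.M_semimeasure, Universal.M_lowerSemicomputable, Universal.M_dominates⟩

/-- A fixed universal continuous semimeasure `𝐌`. -/
noncomputable def universalSemimeasure : List Bool → ℝ :=
  Classical.choose exists_isUniversalSemimeasure

theorem universalSemimeasure_spec : IsUniversalSemimeasure universalSemimeasure :=
  Classical.choose_spec exists_isUniversalSemimeasure

/-- The value `P(S) = ∑_{σ ∈ S} P(σ)`; it is only used for the finite sets `level Q n`. -/
noncomputable def weight (P : List Bool → ℝ) (S : Set (List Bool)) : ℝ := ∑' σ : S, P σ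

/-! ### Deep effectively closed classes -/

/-- Effectively closed subsets of Cantor space: the sequences avoiding a c.e. set of strings. -/
def IsPi01Class (Q : Set (ℕ → Bool)) : Prop :=
  ∃ W : List Bool → Prop, REPred W ∧ Q = {X | ∀ n, ¬ W (initSeg X n)}

/-- The canonical tree of `Q`: all initial segments of members of `Q`. -/
def canonicalTree (Q : Set (ℕ → Bool)) : Set (List Bool) :=
  {σ | ∃ X ∈ Q, ∃ n, σ = initSeg X n}

/-- The strings of length `n` in the canonical tree. -/
def level (Q : Set (ℕ → Bool)) (n : ℕ) : Set (List Bool) :=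
  {σ | σ ∈ canonicalTree Q ∧ σ.length = n}

/-- Computable orders: computable, nondecreasing and unbounded functions. -/
structure IsComputableOrder (g : ℕ → ℕ) : Prop where
  computable : Computable g
  monotone : Monotone g
  unbounded : ∀ k, ∃ n, k ≤ g n

/-- Deep `Π⁰₁` classes. -/
structure IsDeepPi01Class (Q : Set (ℕ → Bool)) : Prop where
  isPi01Class : IsPi01Class Q
  deep : ∃ g, IsComputableOrder g ∧
    ∀ n, weight universalSemimeasure (level Q n) ≤ (2 : ℝ) ^ (-(g n : ℤ))

/-! ### Partial computable functions, the halting set and index sets -/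

/-- The standard enumeration `φ_0, φ_1, …` of the partial computable functions. -/
def phi (e : ℕ) : ℕ →. ℕ := (Denumerable.ofNat Nat.Partrec.Code e).eval

/-- The halting set `∅' = {e : φ_e(e)↓}`. -/
def haltingSet : Set ℕ := {e | (phi e e).Dom}

/-- Index sets: sets of indices closed under equality of the indexed partial functions. -/
def IsIndexSet (C : Set ℕ) : Prop := ∀ e i, phi e = phi i → e ∈ C → i ∈ C

/-! ### Oracle computations and the jump -/

/-- Programs with an oracle: the constructors of `Nat.Partrec.Code` and one for oracle queries. -/
inductive OracleCode : Type
  | zero : OracleCode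
  | succ : OracleCode
  | left : OracleCode
  | right : OracleCode
  | oracle : OracleCode
  | pair : OracleCode → OracleCode → OracleCode
  | comp : OracleCode → OracleCode → OracleCode
  | prec : OracleCode → OracleCode → OracleCode
  | rfind' : OracleCode → OracleCode

namespace OracleCode

/-- The partial function computed by a program with oracle `X`; all clauses except the one for
`oracle` are those of `Nat.Partrec.Code.eval`. -/
def eval (X : ℕ → Bool) : OracleCode → ℕ →. ℕ
  | zero => pure 0
  | succ => Nat.succ
  | left => ↑fun n : ℕ => n.unpair.1
  | right => ↑fun n : ℕ => n.unpair.2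
  | oracle => ↑fun n : ℕ => (X n).toNat
  | pair cf cg => fun n => Nat.pair <$> eval X cf n <*> eval X cg n
  | comp cf cg => fun n => eval X cg n >>= eval X cf
  | prec cf cg =>
    Nat.unpaired fun a n =>
      n.rec (eval X cf a) fun y IH => do
        let i ← IH
        eval X cg (Nat.pair a (Nat.pair y i))
  | rfind' cf =>
    Nat.unpaired fun a m =>
      (Nat.rfind fun n => (fun m => m = 0) <$> eval X cf (Nat.pair a (n + m))).map (· + m)

/-- The index of a program. -/
def index : OracleCode → ℕ
  | zero => 0
  | succ => 1
  | left => 2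
  | right => 3
  | oracle => 4
  | pair cf cg => 2 * (2 * Nat.pair (index cf) (index cg)) + 5
  | comp cf cg => 2 * (2 * Nat.pair (index cf) (index cg) + 1) + 5
  | prec cf cg => (2 * (2 * Nat.pair (index cf) (index cg)) + 1) + 5
  | rfind' cf => (2 * (2 * index cf + 1) + 1) + 5

/-- The program with a given index. -/
def ofIndex : ℕ → OracleCode
  | 0 => zero
  | 1 => succ
  | 2 => left
  | 3 => right
  | 4 => oracle
  | n + 5 =>
    let m := n.div2.div2
    have hm : m < n + 5 := by
      simp only [m, Nat.div2_val]
      omega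
    have _m1 : m.unpair.1 < n + 5 := lt_of_le_of_lt m.unpair_left_le hm
    have _m2 : m.unpair.2 < n + 5 := lt_of_le_of_lt m.unpair_right_le hm
    match n.bodd, n.div2.bodd with
    | false, false => pair (ofIndex m.unpair.1) (ofIndex m.unpair.2)
    | false, true => comp (ofIndex m.unpair.1) (ofIndex m.unpair.2)
    | true, false => prec (ofIndex m.unpair.1) (ofIndex m.unpair.2)
    | true, true => rfind' (ofIndex m)
  decreasing_by
    all_goals first | exact _m1 | exact _m2 | exact hm

theorem ofIndex_index (c : OracleCode) : ofIndex (index c) = c := by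
  induction c <;> simp [index, ofIndex, Nat.div2_val, *]

end OracleCode

/-- The standard enumeration `φ_0^X, φ_1^X, …` of the functions partial computable in `X`. -/
def phiOracle (X : ℕ → Bool) (e : ℕ) : ℕ →. ℕ := (OracleCode.ofIndex e).eval X

/-- The jump `X' = {e : φ_e^X(e)↓}`. -/
def jump (X : ℕ → Bool) : Set ℕ := {e | (phiOracle X e e).Dom}

end DeepClass

/-!
Each of the three sets `A` separates, along a computable map `t`, the programs for some partial
computable function `f` from the programs for some other one `g`: for the halting set and the jump,
`f` is total and `g` is nowhere defined; for an index set, `f` and `g` have an index inside and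
outside of it. Hence, if `c` is a program computing a partial function with values in `{0, 1}`, there
are computable positions `h c j` such that `A` differs at position `h c j` from the value `c(j)`
whenever that value is defined: `h c j` is the image under `t` of a program that waits for `c(j)` and
then behaves like `f` or like `g`. So `A` belongs to the effectively closed class
`avoidingClass c (h c)` (`exists_isDeepPi01Class_of_separating`).

It remains to choose `c` such that this class is deep
(`exists_isDeepPi01Class_avoidingClass`). By the recursion theorem, `c` may use its own positions
`h c j`. For each `k` a block of `2 ^ (k + 1)` of these positions is used, together with a length
`n` exceeding all of them. Start with all strings of length `n`. As long as the mass of the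
remaining strings exceeds `2 ^ (-k)`, which is noticed at some finite stage because the semimeasure
is lower semicomputable, `c` forbids at the next position of the block the bit that carries at least
half of the mass seen so far. This removes strings of mass more than `2 ^ (-(k + 1))`
(`mass_avoid_le`). As the total mass is at most `1`, the block is not used up before the mass of the
remaining strings drops to `2 ^ (-k)` (`exists_remaining_mass_le`), and all members of the class have
their initial segment of length `n` among these (`initSeg_mem_remaining`). Since mass does not
increase when strings are extended, `2 ^ (-k)` also bounds all later levels (`weight_level_le`).
-/

namespace DeepClass

open Filter Topology

/-! ### Lists of strings and their mass -/

/-- The sum of `f` over a list of strings. -/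
def mass {R : Type*} [AddCommMonoid R] (f : List Bool → R) (S : List (List Bool)) : R :=
  (S.map f).sum

/-- The strings in `S` whose bit at position `p` is not `v`. -/
def avoid (S : List (List Bool)) (p : ℕ) (v : Bool) : List (List Bool) :=
  S.filter fun σ => σ.getD p false ≠ v

/-- All extensions by `d` bits of the strings in `S`. -/
def extensions (S : List (List Bool)) : ℕ → List (List Bool)
  | 0 => S
  | d + 1 => (extensions S d).flatMap fun σ => [σ ++ [false], σ ++ [true]]

theorem mass_avoid_add {R : Type*} [AddCommMonoid R] (f : List Bool → R) (S : List (List Bool))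
    (p : ℕ) (v : Bool) : mass f (avoid S p v) + mass f (avoid S p (!v)) = mass f S := by
  induction S with
  | nil => simp [mass, avoid]
  | cons σ S ih =>
    simp only [mass, avoid] at ih ⊢
    rw [List.map_cons, List.sum_cons, ← ih, List.filter_cons, List.filter_cons]
    generalize σ.getD p false = b
    cases b <;> cases v <;> simp <;> abel

theorem mass_nonneg {P : List Bool → ℝ} (hP : ∀ σ, 0 ≤ P σ) (S : List (List Bool)) :
    0 ≤ mass P S :=
  List.sum_nonneg (by simpa [mass] using fun σ _ => hP σ)

theorem mass_extensions_le {P : List Bool → ℝ} (hP : IsContinuousSemimeasure P)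
    (S : List (List Bool)) (d : ℕ) : mass P (extensions S d) ≤ mass P S := by
  induction d with
  | zero => exact le_rfl
  | succ d ih =>
    refine le_trans ?_ ih
    rw [extensions]
    generalize extensions S d = T
    induction T with
    | nil => simp [mass]
    | cons σ T ih =>
      simp only [mass, List.flatMap_cons, List.map_append, List.sum_append, List.map_cons,
        List.map_nil, List.sum_cons, List.sum_nil] at ih ⊢
      linarith [hP.superadditive σ]

theorem initSeg_succ (X : ℕ → Bool) (n : ℕ) : initSeg X (n + 1) = initSeg X n ++ [X n] := by
  simp [initSeg, List.range_succ]

theorem length_initSeg (X : ℕ → Bool) (n : ℕ) : (initSeg X n).length = n := by simp [initSeg]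

theorem getElem?_initSeg (X : ℕ → Bool) {n p : ℕ} (h : p < n) : (initSeg X n)[p]? = some (X p) := by
  simp [initSeg, h]

theorem initSeg_mem_extensions {X : ℕ → Bool} {n : ℕ} {S : List (List Bool)}
    (h : initSeg X n ∈ S) (d : ℕ) : initSeg X (n + d) ∈ extensions S d := by
  induction d with
  | zero => exact h
  | succ d ih =>
    rw [extensions, List.mem_flatMap]
    refine ⟨_, ih, ?_⟩
    rw [← Nat.add_assoc, initSeg_succ]
    cases X (n + d) <;> simp

theorem mass_toFinset_le {P : List Bool → ℝ} (hP : ∀ σ, 0 ≤ P σ) (S : List (List Bool)) :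
    ∑ σ ∈ S.toFinset, P σ ≤ mass P S := by
  induction S with
  | nil => simp [mass]
  | cons σ S ih =>
    rw [List.toFinset_cons]
    simp only [mass, List.map_cons, List.sum_cons] at ih ⊢
    by_cases h : σ ∈ S.toFinset
    · rw [Finset.insert_eq_of_mem h]
      linarith [hP σ]
    · rw [Finset.sum_insert h]
      linarith

theorem weight_le_mass {P : List Bool → ℝ} (hP : ∀ σ, 0 ≤ P σ) {T : Set (List Bool)}
    {S : List (List Bool)} (h : ∀ σ ∈ T, σ ∈ S) : weight P T ≤ mass P S := by
  refine le_trans ?_ (mass_toFinset_le hP S)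
  rw [weight, tsum_subtype T P, tsum_eq_sum (s := S.toFinset)]
  · exact Finset.sum_le_sum fun σ _ => Set.indicator_le_self' (fun _ _ => hP _) σ
  · intro σ hσ
    exact Set.indicator_of_notMem (fun hT => hσ (List.mem_toFinset.2 (h σ hT))) _

/-- If all members of `Q` have their initial segment of length `n` in `S`, then beyond level `n` the
weight of the levels of `Q` is at most the mass of `S`. -/
theorem weight_level_le {P : List Bool → ℝ} (hP : IsContinuousSemimeasure P) {Q : Set (ℕ → Bool)}
    {S : List (List Bool)} {n : ℕ} (h : ∀ X ∈ Q, initSeg X n ∈ S) {m : ℕ} (hm : n ≤ m) :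
    weight P (level Q m) ≤ mass P S := by
  refine le_trans (weight_le_mass hP.nonneg ?_) (mass_extensions_le hP S (m - n))
  rintro σ ⟨⟨X, hX, l, rfl⟩, hl⟩
  obtain rfl : l = m := by rw [← hl, length_initSeg]
  have := initSeg_mem_extensions (h X hX) (l - n)
  rwa [Nat.add_sub_cancel' hm] at this

/-! ### Dyadic approximations -/

/-- `m` approximates `P` from below: `m σ s / 2 ^ s` is at most `P σ` and tends to `P σ`. -/
structure IsDyadicApprox (m : List Bool → ℕ → ℕ) (P : List Bool → ℝ) : Prop where
  le : ∀ σ s, (m σ s : ℝ) ≤ 2 ^ s * P σ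
  tendsto : ∀ σ, Tendsto (fun s => (m σ s : ℝ) / 2 ^ s) atTop (𝓝 (P σ))

theorem IsLowerSemicomputable.exists_dyadicApprox {P : List Bool → ℝ}
    (hP : IsLowerSemicomputable P) : ∃ m, Computable₂ m ∧ IsDyadicApprox m P := by
  obtain ⟨a, b, ha, hb, hab⟩ := hP
  refine ⟨fun σ s => 2 ^ s * a σ s / (b σ s + 1), ?_, ?_, ?_⟩
  · exact Primrec.nat_div.to_comp.comp (Primrec.nat_mul.to_comp.comp
      (Universal.primrec_pow.to_comp.comp (Computable.const 2) Computable.snd) ha)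
      (Computable.succ.comp hb)
  · intro σ s
    calc _ ≤ ((2 ^ s * a σ s : ℕ) : ℝ) / ((b σ s + 1 : ℕ) : ℝ) := Nat.cast_div_le
      _ = 2 ^ s * ((a σ s : ℝ) / ((b σ s : ℝ) + 1)) := by push_cast; ring
      _ ≤ _ := by gcongr; exact (hab σ).1.ge_of_tendsto (hab σ).2 s
  · intro σ
    have h0 : Tendsto (fun s : ℕ => (1 / 2 : ℝ) ^ s) atTop (𝓝 0) :=
      tendsto_pow_atTop_nhds_zero_of_lt_one (by norm_num) (by norm_num)
    have h1 := (hab σ).2.sub h0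
    rw [sub_zero] at h1
    refine tendsto_of_tendsto_of_tendsto_of_le_of_le h1 (hab σ).2 (fun s => ?_) (fun s => ?_)
    · have h2 : (2 ^ s * a σ s : ℝ) ≤
          (((2 ^ s * a σ s / (b σ s + 1) : ℕ) : ℝ) + 1) * (b σ s + 1) := by
        exact_mod_cast (Nat.lt_mul_of_div_lt (Nat.lt_succ_self (2 ^ s * a σ s / (b σ s + 1)))
          (Nat.succ_pos _)).le
      dsimp only
      rw [sub_le_iff_le_add, one_div, inv_pow, ← one_div, ← add_div,
        div_le_div_iff₀ (by positivity) (by positivity)]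
      linarith
    · dsimp only
      rw [div_le_iff₀ (by positivity)]
      calc _ ≤ ((2 ^ s * a σ s : ℕ) : ℝ) / ((b σ s + 1 : ℕ) : ℝ) := Nat.cast_div_le
        _ = _ := by push_cast; ring

variable {m : List Bool → ℕ → ℕ} {P : List Bool → ℝ}

theorem IsDyadicApprox.mass_le (h : IsDyadicApprox m P) (S : List (List Bool)) (s : ℕ) :
    ((mass (m · s) S : ℕ) : ℝ) ≤ 2 ^ s * mass P S := by
  induction S with
  | nil => simp [mass]
  | cons σ S ih =>
    simp only [mass, List.map_cons, List.sum_cons, Nat.cast_add] at ih ⊢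
    linarith [h.le σ s]

theorem IsDyadicApprox.tendsto_mass (h : IsDyadicApprox m P) (S : List (List Bool)) :
    Tendsto (fun s => ((mass (m · s) S : ℕ) : ℝ) / 2 ^ s) atTop (𝓝 (mass P S)) := by
  induction S with
  | nil => simp [mass]
  | cons σ S ih =>
    simp only [mass, List.map_cons, List.sum_cons, Nat.cast_add, add_div] at ih ⊢
    exact (h.tendsto σ).add ih

/-! ### The diagonalization against a block of positions -/

/-- The first stage at which the approximation `m` shows that the mass of `S` exceeds `2 ^ (-k)`. -/
def search (m : List Bool → ℕ → ℕ) (k : ℕ) (S : List (List Bool)) : Part ℕ :=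
  Nat.rfind fun s => Part.some (decide (2 ^ s < 2 ^ k * mass (m · s) S))

/-- The bit at position `p` that carries at least half of the mass of `S` at stage `s`. -/
def majority (m : List Bool → ℕ → ℕ) (s : ℕ) (S : List (List Bool)) (p : ℕ) : Bool :=
  decide (mass (m · s) S ≤ 2 * mass (m · s) (avoid S p false))

/-- The value that is to be avoided at position `p`, when the strings in `S` are left; undefined if
the mass of `S` is at most `2 ^ (-k)`. -/
def forbidden (m : List Bool → ℕ → ℕ) (k : ℕ) (S : List (List Bool)) (p : ℕ) : Part Bool :=
  (search m k S).map fun s => majority m s S p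

/-- The strings of length `n` that are left after the positions `p 0, …, p (i - 1)` have been
treated one after the other. -/
def remaining (m : List Bool → ℕ → ℕ) (k n : ℕ) (p : ℕ → ℕ) (i : ℕ) : Part (List (List Bool)) :=
  Nat.rec (Part.some (extensions [[]] n))
    (fun i R => R.bind fun S => (forbidden m k S (p i)).map (avoid S (p i))) i

/-- The value that the diagonalization forbids at position `p i`. -/
def diag (m : List Bool → ℕ → ℕ) (k n : ℕ) (p : ℕ → ℕ) (i : ℕ) : Part Bool :=
  (remaining m k n p i).bind fun S => forbidden m k S (p i)

variable {k n : ℕ} {p : ℕ → ℕ}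

theorem mem_remaining_succ {i : ℕ} {T : List (List Bool)} :
    T ∈ remaining m k n p (i + 1) ↔
      ∃ S ∈ remaining m k n p i, ∃ v ∈ forbidden m k S (p i), avoid S (p i) v = T := by
  change T ∈ (remaining m k n p i).bind _ ↔ _
  simp

theorem mass_le_of_not_dom (hm : IsDyadicApprox m P) {S : List (List Bool)}
    (h : ¬ (search m k S).Dom) : mass P S ≤ (2 : ℝ) ^ (-(k : ℤ)) := by
  refine le_of_tendsto' (hm.tendsto_mass S) fun s => ?_
  have h1 : ¬ 2 ^ s < 2 ^ k * mass (m · s) S := fun hs =>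
    h (Nat.rfind_dom.2 ⟨s, by simpa using hs, fun _ => trivial⟩)
  have h2 : (2 ^ k * (mass (m · s) S : ℕ) : ℝ) ≤ 2 ^ s := by exact_mod_cast not_lt.1 h1
  rw [zpow_neg, zpow_natCast, div_le_iff₀ (by positivity), inv_mul_eq_div,
    le_div_iff₀ (by positivity)]
  linarith

/-- Forbidding the majority value costs more than `2 ^ (-(k + 1))` of the mass. -/
theorem mass_avoid_le (hm : IsDyadicApprox m P) {S : List (List Bool)} {q : ℕ} {v : Bool}
    (hv : v ∈ forbidden m k S q) : mass P (avoid S q v) ≤ mass P S - 1 / 2 ^ (k + 1) := by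
  obtain ⟨s, hs, rfl⟩ := (Part.mem_map_iff _).1 hv
  have h1 : 2 ^ s < 2 ^ k * mass (m · s) S := by
    simpa using Nat.rfind_spec hs
  have h2 : mass (m · s) S ≤ 2 * mass (m · s) (avoid S q (!majority m s S q)) := by
    have := mass_avoid_add (m · s) S q false
    by_cases h : mass (m · s) S ≤ 2 * mass (m · s) (avoid S q false)
    · simp [majority, h]
    · simp only [majority, h, decide_false, Bool.not_false] at this ⊢
      omega
  have h3 := hm.mass_le (avoid S q (!majority m s S q)) s
  have h4 : (2 ^ s : ℝ) < 2 ^ k * (2 * mass (m · s) (avoid S q (!majority m s S q)) : ℕ) := by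
    exact_mod_cast h1.trans_le (Nat.mul_le_mul_left _ h2)
  rw [← mass_avoid_add P S q (majority m s S q)]
  suffices 1 / 2 ^ (k + 1) ≤ mass P (avoid S q (!majority m s S q)) by linarith
  rw [div_le_iff₀ (by positivity)]
  have h5 : (2 ^ s : ℝ) * 1 ≤ 2 ^ s * (mass P (avoid S q (!majority m s S q)) * 2 ^ (k + 1)) := by
    push_cast at h4
    calc (2 ^ s : ℝ) * 1 ≤ 2 ^ k * (2 * (mass (m · s) (avoid S q (!majority m s S q)) : ℕ)) := by
          linarith
      _ ≤ 2 ^ k * (2 * (2 ^ s * mass P (avoid S q (!majority m s S q)))) := by gcongr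
      _ = _ := by ring
  exact le_of_mul_le_mul_left h5 (by positivity)

theorem mass_remaining_le (hP : IsContinuousSemimeasure P) (hm : IsDyadicApprox m P) {i : ℕ}
    {S : List (List Bool)} (hS : S ∈ remaining m k n p i) :
    mass P S ≤ 1 - i * (1 / 2 ^ (k + 1)) := by
  induction i generalizing S with
  | zero =>
    obtain rfl : S = extensions [[]] n := by simpa [remaining] using hS
    refine (mass_extensions_le hP _ _).trans ?_
    simpa [mass] using hP.root_le_one
  | succ i ih =>
    obtain ⟨T, hT, v, hv, rfl⟩ := mem_remaining_succ.1 hS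
    have := ih hT
    have := mass_avoid_le hm hv
    push_cast
    linarith

theorem exists_remaining_mass_le (hP : IsContinuousSemimeasure P) (hm : IsDyadicApprox m P)
    (k n : ℕ) (p : ℕ → ℕ) :
    ∃ i ≤ 2 ^ (k + 1), ∃ S ∈ remaining m k n p i, mass P S ≤ (2 : ℝ) ^ (-(k : ℤ)) := by
  by_contra! hc
  have key : ∀ i ≤ 2 ^ (k + 1), ∃ S, S ∈ remaining m k n p i := by
    intro i hi
    induction i with
    | zero => exact ⟨_, Part.mem_some _⟩
    | succ i ih =>
      obtain ⟨S, hS⟩ := ih (by omega)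
      have hd : (search m k S).Dom := by
        by_contra h
        exact (hc i (by omega) S hS).not_ge (mass_le_of_not_dom hm h)
      obtain ⟨s, hs⟩ := Part.dom_iff_mem.1 hd
      exact ⟨_, mem_remaining_succ.2 ⟨S, hS, _, Part.mem_map _ hs, rfl⟩⟩
  obtain ⟨S, hS⟩ := key _ le_rfl
  refine (hc _ le_rfl S hS).not_ge ((mass_remaining_le hP hm hS).trans ?_)
  push_cast
  rw [mul_one_div_cancel (by positivity), sub_self]
  positivity

theorem initSeg_mem_remaining {X : ℕ → Bool} {i : ℕ} {S : List (List Bool)}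
    (hS : S ∈ remaining m k n p i) (hp : ∀ j < i, p j < n)
    (hX : ∀ j < i, X (p j) ∉ diag m k n p j) : initSeg X n ∈ S := by
  induction i generalizing S with
  | zero =>
    obtain rfl : S = extensions [[]] n := by simpa [remaining] using hS
    simpa using initSeg_mem_extensions (X := X) (n := 0) (S := [[]]) (by simp [initSeg]) n
  | succ i ih =>
    obtain ⟨T, hT, v, hv, rfl⟩ := mem_remaining_succ.1 hS
    refine List.mem_filter.2
      ⟨ih hT (fun j hj => hp j (by omega)) (fun j hj => hX j (by omega)), ?_⟩
    rw [decide_eq_true_iff, List.getD_eq_getElem?_getD, getElem?_initSeg X (hp i (by omega))]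
    rintro rfl
    exact hX i (by omega) (Part.mem_bind hT hv)

/-! ### Computability of the diagonalization -/

theorem computable_list_sum_map {α β : Type*} [Primcodable α] [Primcodable β] {l : α → List β}
    {f : α → β → ℕ} (hl : Computable l) (hf : Computable₂ f) :
    Computable fun a => ((l a).map (f a)).sum := by
  have h1 : Computable fun q : (α × ℕ × ℕ) => (l q.1)[q.2.1]? :=
    Computable.list_getElem?.comp (hl.comp Computable.fst) (Computable.fst.comp Computable.snd)
  have h2 : Computable₂ fun (q : α × ℕ × ℕ) (b : β) => f q.1 b :=
    hf.comp (Computable.fst.comp Computable.fst) Computable.snd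
  refine (Computable.nat_rec (f := fun a => (l a).length) (g := fun _ => 0)
    (h := fun a q => q.2 + (((l a)[q.1]?).map (f a)).getD 0)
    (Computable.list_length.comp hl) (Computable.const 0)
    (Primrec.nat_add.to_comp.comp (Computable.snd.comp Computable.snd)
      (Computable.option_getD (Computable.option_map h1 h2) (Computable.const 0)))).of_eq ?_
  intro a
  have key : ∀ n ≤ (l a).length, Nat.rec (motive := fun _ => ℕ) 0
      (fun i r => r + (((l a)[i]?).map (f a)).getD 0) n = (((l a).take n).map (f a)).sum := by
    intro n hn
    induction n with
    | zero => simp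
    | succ n ih =>
      rw [List.take_succ_eq_append_getElem (show n < (l a).length by omega), List.map_append,
        List.sum_append, ← ih (by omega)]
      simp [List.getElem?_eq_getElem (show n < (l a).length by omega)]
  simpa using key _ le_rfl

theorem computable_decide_le : Computable₂ fun a b : ℕ => decide (a ≤ b) :=
  Primrec.nat_le.decide.to_comp

theorem computable_decide_lt : Computable₂ fun a b : ℕ => decide (a < b) :=
  Primrec.nat_lt.decide.to_comp

theorem primrec_extensions : Primrec₂ extensions := by
  refine (Primrec.nat_rec (f := fun S : List (List Bool) => S)
    (g := fun _ q => q.2.flatMap fun σ => [σ ++ [false], σ ++ [true]]) Primrec.id ?_).of_eq ?_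
  · refine Primrec.list_flatMap (Primrec.snd.comp Primrec.snd) ?_
    exact Primrec.list_cons.comp (Primrec.list_concat.comp Primrec.snd (Primrec.const false))
      (Primrec.list_cons.comp (Primrec.list_concat.comp Primrec.snd (Primrec.const true))
        (Primrec.const []))
  · intro S d
    induction d with
    | zero => rfl
    | succ d ih => simp only [extensions, ← ih]

theorem primrec_avoid :
    Primrec fun q : List (List Bool) × ℕ × Bool => avoid q.1 q.2.1 q.2.2 := by
  have h : PrimrecRel fun (σ : List Bool) (q : ℕ × Bool) => σ.getD q.1 false ≠ q.2 :=
    (Primrec.eq.comp ((Primrec.list_getD false).comp Primrec.fst (Primrec.fst.comp Primrec.snd))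
      (Primrec.snd.comp Primrec.snd)).not
  exact h.listFilter

section

variable {m : List Bool → ℕ → ℕ} {α : Type*} [Primcodable α]

theorem computable_mass (hm : Computable₂ m) :
    Computable₂ fun (S : List (List Bool)) (s : ℕ) => mass (m · s) S :=
  computable_list_sum_map Computable.fst
    (hm.comp Computable.snd (Computable.snd.comp Computable.fst))

theorem computable_majority (hm : Computable₂ m) :
    Computable fun q : (ℕ × List (List Bool) × ℕ) => majority m q.1 q.2.1 q.2.2 := by
  have hS : Computable fun q : ℕ × List (List Bool) × ℕ => q.2.1 :=
    Computable.fst.comp Computable.snd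
  have hav : Computable fun q : ℕ × List (List Bool) × ℕ => avoid q.2.1 q.2.2 false :=
    (primrec_avoid.to_comp.comp
      (hS.pair ((Computable.snd.comp Computable.snd).pair (Computable.const false))) :)
  exact computable_decide_le.comp ((computable_mass hm).comp hS Computable.fst)
    (Primrec.nat_mul.to_comp.comp (Computable.const 2)
      ((computable_mass hm).comp hav Computable.fst))

theorem partrec_forbidden (hm : Computable₂ m) :
    Partrec fun q : ℕ × List (List Bool) × ℕ => forbidden m q.1 q.2.1 q.2.2 := by
  have hs : Partrec fun q : ℕ × List (List Bool) × ℕ => search m q.1 q.2.1 := by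
    refine Partrec.rfind (Computable.partrec ?_)
    have hp : ∀ {f : (ℕ × List (List Bool) × ℕ) × ℕ → ℕ}, Computable f →
        Computable fun q => 2 ^ f q := fun hf =>
      Universal.primrec_pow.to_comp.comp (Computable.const 2) hf
    exact computable_decide_lt.comp (hp Computable.snd)
      (Primrec.nat_mul.to_comp.comp (hp (Computable.fst.comp Computable.fst))
        ((computable_mass hm).comp (Computable.fst.comp (Computable.snd.comp Computable.fst))
          Computable.snd))
  have hmaj := (computable_majority hm).comp (Computable.snd.pair (Computable.snd.comp
    (Computable.fst (α := ℕ × List (List Bool) × ℕ) (β := ℕ))))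
  exact hs.map hmaj

theorem partrec_diag (hm : Computable₂ m) {k n : α → ℕ} {p : α → ℕ → ℕ} {i : α → ℕ}
    (hk : Computable k) (hn : Computable n) (hp : Computable₂ p) (hi : Computable i) :
    Partrec fun a => diag m (k a) (n a) (p a) (i a) := by
  have hr : Partrec fun a => remaining m (k a) (n a) (p a) (i a) := by
    refine Partrec.nat_rec (g := fun a => Part.some (extensions [[]] (n a)))
      (h := fun a q => (forbidden m (k a) q.2 (p a q.1)).map (avoid q.2 (p a q.1))) hi
      (primrec_extensions.to_comp.comp (Computable.const [[]]) hn).partrec ?_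
    have hS : Computable fun q : α × ℕ × List (List Bool) => q.2.2 :=
      Computable.snd.comp Computable.snd
    have hq : Computable fun q : α × ℕ × List (List Bool) => p q.1 q.2.1 :=
      hp.comp Computable.fst (Computable.fst.comp Computable.snd)
    have hf := (partrec_forbidden hm).comp ((hk.comp Computable.fst).pair (hS.pair hq))
    have hav := primrec_avoid.to_comp.comp ((hS.comp (Computable.fst (β := Bool))).pair
      ((hq.comp Computable.fst).pair Computable.snd))
    exact hf.map hav
  have hf := (partrec_forbidden hm).comp ((hk.comp Computable.fst).pair
    (Computable.snd.pair ((hp.comp Computable.id hi).comp Computable.fst)))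
  exact hr.bind hf

theorem computable_findGreatest {N : ℕ → ℕ} (hN : Computable N) :
    Computable fun n => Nat.findGreatest (fun k => N k ≤ n) n := by
  refine (Computable.nat_rec (f := fun n : ℕ => n) (g := fun _ => 0)
    (h := fun n q => bif decide (N (q.1 + 1) ≤ n) then q.1 + 1 else q.2)
    Computable.id (Computable.const 0) ?_).of_eq ?_
  · have h1 : Computable fun q : ℕ × ℕ × ℕ => q.2.1 + 1 :=
      Computable.succ.comp (Computable.fst.comp Computable.snd)
    exact Computable.cond (computable_decide_le.comp (hN.comp h1) Computable.fst) h1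
      (Computable.snd.comp Computable.snd)
  · intro n
    have key : ∀ r, Nat.rec (motive := fun _ => ℕ) 0
        (fun i r => bif decide (N (i + 1) ≤ n) then i + 1 else r) r
        = Nat.findGreatest (fun k => N k ≤ n) r := by
      intro r
      induction r with
      | zero => rfl
      | succ r ih => rw [Nat.findGreatest_succ, ← ih]; simp [Bool.cond_decide]
    exact key n

end

/-! ### Deep classes from computable sequences of positions -/

/-- The sequences that avoid, at each position `h j`, the bit `c(j)` if this is defined. -/
def avoidingClass (c : Nat.Partrec.Code) (h : ℕ → ℕ) : Set (ℕ → Bool) :=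
  {X | ∀ j, (X (h j)).toNat ∉ c.eval j}

theorem isPi01Class_avoidingClass (c : Nat.Partrec.Code) {h : ℕ → ℕ} (hh : Computable h) :
    IsPi01Class (avoidingClass c h) := by
  -- `test σ ⟨j, s⟩` holds if `c` yields, within `s` steps, the bit of `σ` at position `h j`.
  let test (σ : List Bool) (t : ℕ) : Bool :=
    decide ((σ[h t.unpair.1]?).map (fun b => some b.toNat) =
      some (Nat.Partrec.Code.evaln t.unpair.2 c t.unpair.1))
  have htest : Computable₂ test := by
    have h1 : Computable fun q : List Bool × ℕ => q.2.unpair.1 :=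
      Computable.fst.comp (Computable.unpair.comp Computable.snd)
    have h2 : Computable fun q : List Bool × ℕ => q.2.unpair.2 :=
      Computable.snd.comp (Computable.unpair.comp Computable.snd)
    have h3 : Computable fun q : List Bool × ℕ =>
        Nat.Partrec.Code.evaln q.2.unpair.2 c q.2.unpair.1 :=
      Nat.Partrec.Code.primrec_evaln.to_comp.comp ((h2.pair (Computable.const c)).pair h1)
    have h4 : Computable Bool.toNat :=
      (Primrec.dom_finite _).to_comp
    refine Primrec.eq.decide.to_comp.comp
      (Computable.option_map (Computable.list_getElem?.comp Computable.fst (hh.comp h1))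
        (Computable.option_some.comp (h4.comp Computable.snd)))
      (Computable.option_some.comp h3)
  refine ⟨fun σ => ∃ t, test σ t = true, ?_, ?_⟩
  · refine ((Partrec.rfind (p := fun σ t => Part.some (test σ t)) htest.partrec).map
      (Computable.const ()).to₂).of_eq fun σ => ?_
    refine Part.ext fun u => ?_
    have hdom : (Nat.rfind fun t => Part.some (test σ t)).Dom ↔ ∃ t, test σ t = true :=
      Nat.rfind_dom'.trans (by simp)
    simp [Part.mem_assert_iff, ← Part.dom_iff_mem, hdom]
  · ext X
    simp only [avoidingClass, Set.mem_ofPred_eq, not_exists]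
    constructor
    · intro hX n t ht
      rw [decide_eq_true_iff, Option.map_eq_some_iff] at ht
      obtain ⟨b, hb, hv⟩ := ht
      have hlt : h t.unpair.1 < n := by
        by_contra hge
        rw [List.getElem?_eq_none (by rw [length_initSeg]; omega)] at hb
        cases hb
      rw [getElem?_initSeg X hlt, Option.some_inj] at hb
      exact hX t.unpair.1 (hb ▸ Nat.Partrec.Code.evaln_sound hv.symm)
    · intro hX j hj
      obtain ⟨s, hs⟩ := Nat.Partrec.Code.evaln_complete.1 hj
      refine hX (h j + 1) (Nat.pair j s) ?_
      rw [Option.mem_def] at hs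
      simp only [test, Nat.unpair_pair, getElem?_initSeg X (Nat.lt_succ_self (h j)), hs]
      exact decide_eq_true rfl

open Nat.Partrec (Code)

/-- For a computable family of sequences of positions, indexed by programs, some program `c` forbids
values at its own positions `h c 0, h c 1, …` in such a way that the resulting class is deep. The
recursion theorem lets the diagonalization know the positions that `c` itself gives rise to. -/
theorem exists_isDeepPi01Class_avoidingClass {h : Code → ℕ → ℕ} (hh : Computable₂ h) :
    ∃ c : Code, IsDeepPi01Class (avoidingClass c (h c)) := by
  obtain ⟨m, hmc, hm⟩ := universalSemimeasure_spec.lowerSemicomputable.exists_dyadicApprox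
  have hP := universalSemimeasure_spec.semimeasure
  -- Block `k` consists of the positions `p c k i` with `i < 2 ^ (k + 1)`, all below `N c k`.
  let p (c : Code) (k i : ℕ) : ℕ := h c (Nat.pair k i)
  let N (c : Code) (k : ℕ) : ℕ := ((List.range (2 ^ (k + 1))).map fun i => p c k i + 1).sum
  have hp : Computable fun q : (Code × ℕ) × ℕ => p q.1.1 q.1.2 q.2 :=
    hh.comp (Computable.fst.comp Computable.fst)
      (Primrec₂.natPair.to_comp.comp (Computable.snd.comp Computable.fst) Computable.snd)
  have hN : Computable₂ N := by
    refine computable_list_sum_map (Primrec.list_range.to_comp.comp ?_) (Computable.succ.comp hp)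
    exact Universal.primrec_pow.to_comp.comp (Computable.const 2)
      (Computable.succ.comp Computable.snd)
  have hlt : ∀ c k, ∀ i < 2 ^ (k + 1), p c k i < N c k := fun c k i hi =>
    List.single_le_sum (fun _ _ => Nat.zero_le _) _
      (List.mem_map.2 ⟨i, List.mem_range.2 hi, rfl⟩)
  obtain ⟨c, hc⟩ := Nat.Partrec.Code.fixed_point₂ (f := fun c j =>
    (diag m j.unpair.1 (N c j.unpair.1) (p c j.unpair.1) j.unpair.2).map Bool.toNat) (by
      have hk : Computable fun q : Code × ℕ => q.2.unpair.1 :=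
        Computable.fst.comp (Computable.unpair.comp Computable.snd)
      have hi : Computable fun q : Code × ℕ => q.2.unpair.2 :=
        Computable.snd.comp (Computable.unpair.comp Computable.snd)
      have hpq := hp.comp (((Computable.fst.comp Computable.fst).pair
        (hk.comp Computable.fst)).pair Computable.snd)
      have hd := partrec_diag hmc hk (hN.comp Computable.fst hk) hpq.to₂ hi
      exact hd.map ((Primrec.dom_finite Bool.toNat).to_comp.comp Computable.snd).to₂)
  refine ⟨c, isPi01Class_avoidingClass c (hh.comp (Computable.const c) Computable.id),
    fun n => Nat.findGreatest (fun k => N c k ≤ n) n, ⟨?_, ?_, ?_⟩, fun n => ?_⟩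
  · exact computable_findGreatest (hN.comp (Computable.const c) Computable.id)
  · exact fun a b hab => Nat.findGreatest_mono (fun k hk => hk.trans hab) hab
  · exact fun k => ⟨max k (N c k), Nat.le_findGreatest (le_max_left _ _) (le_max_right _ _)⟩
  · dsimp only
    by_cases h0 : Nat.findGreatest (fun k => N c k ≤ n) n = 0
    · -- Here even `N c 0 ≤ n` may fail; the bound `1` holds at every level.
      rw [h0]
      refine (weight_level_le (S := [[]]) (n := 0) hP ?_ (Nat.zero_le n)).trans ?_
      · simp [initSeg]
      · simpa [mass] using hP.root_le_one
    · have hle := Nat.findGreatest_of_ne_zero rfl h0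
      generalize Nat.findGreatest (fun k => N c k ≤ n) n = k at hle ⊢
      obtain ⟨i, hi, S, hS, hmass⟩ := exists_remaining_mass_le hP hm k (N c k) (p c k)
      refine (weight_level_le hP (fun X hX => ?_) hle).trans hmass
      refine initSeg_mem_remaining hS (fun j hj => hlt c k j (by omega)) fun j _ hd =>
        hX (Nat.pair k j) ?_
      rw [hc]
      simpa using Part.mem_map Bool.toNat hd

/-- If a computable map sends all programs for `f` into `A` and all programs for `g` out of `A`,
then `A` belongs to a deep class: a program that waits for a bit `v` and then behaves like `f` or
like `g` forces `A` to differ from `v`, whatever `A` does on programs that wait forever. -/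
theorem exists_isDeepPi01Class_of_separating {A : Set ℕ} {t : Code → ℕ} (ht : Computable t)
    {f g : ℕ →. ℕ} (hf : Partrec f) (hg : Partrec g) (hfA : ∀ d : Code, d.eval = f → t d ∈ A)
    (hgA : ∀ d : Code, d.eval = g → t d ∉ A) :
    ∃ Q : Set (ℕ → Bool), IsDeepPi01Class Q ∧ charSeq A ∈ Q := by
  obtain ⟨E, hE⟩ := Nat.Partrec.Code.exists_code.1 (Partrec.nat_iff.1 (Partrec.cond
    (Primrec.eq.decide.to_comp.comp (Computable.snd.comp Computable.unpair) (Computable.const 0))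
    (hf.comp (Computable.fst.comp Computable.unpair))
    (hg.comp (Computable.fst.comp Computable.unpair))))
  let d (c : Code) (j : ℕ) : Code := E.comp (Code.id.pair (c.comp (Code.const j)))
  have hd : Computable₂ fun c j => t (d c j) := by
    refine ht.comp (Nat.Partrec.Code.primrec₂_comp.comp (Primrec.const E)
      (Nat.Partrec.Code.primrec₂_pair.comp (Primrec.const Code.id)
        (Nat.Partrec.Code.primrec₂_comp.comp Primrec.fst
          (Nat.Partrec.Code.primrec_const.comp Primrec.snd)))).to_comp
  have hev : ∀ c j v, v ∈ c.eval j → (d c j).eval = if v = 0 then f else g := by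
    intro c j v hv
    funext x
    have hcj : c.eval j = Part.some v := Part.eq_some_iff.2 hv
    have : (d c j).eval x = E.eval (Nat.pair x v) := by
      have hcj' : (Part.some j >>= c.eval) = Part.some v := (Part.bind_some j c.eval).trans hcj
      simp only [d, Nat.Partrec.Code.eval, Nat.Partrec.Code.eval_id,
        Nat.Partrec.Code.eval_const, hcj']
      simp only [Seq.seq, Part.map_eq_map, Part.map_some, Part.bind_some]
      exact Part.bind_some _ E.eval
    rw [this, hE]
    by_cases h0 : v = 0 <;> simp [h0]
  obtain ⟨c, hc⟩ := exists_isDeepPi01Class_avoidingClass hd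
  refine ⟨_, hc, fun j hj => ?_⟩
  have hej := hev c j _ hj
  by_cases hA : t (d c j) ∈ A
  · exact hgA (d c j) (by simpa [charSeq, hA] using hej) hA
  · exact hA (hfA (d c j) (by simpa [charSeq, hA] using hej))

/-! ### Programs without oracle queries -/

/-- The index, as a program with an oracle, of a program without oracle queries. -/
def oracleIndex : Code → ℕ
  | .zero => 0
  | .succ => 1
  | .left => 2
  | .right => 3
  | .pair c d => 2 * (2 * Nat.pair (oracleIndex c) (oracleIndex d)) + 5
  | .comp c d => 2 * (2 * Nat.pair (oracleIndex c) (oracleIndex d) + 1) + 5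
  | .prec c d => (2 * (2 * Nat.pair (oracleIndex c) (oracleIndex d)) + 1) + 5
  | .rfind' c => (2 * (2 * oracleIndex c + 1) + 1) + 5

theorem computable_oracleIndex : Computable oracleIndex := by
  have hpair : Primrec fun q : Code × Code × Code × ℕ × ℕ => Nat.pair q.2.2.2.1 q.2.2.2.2 :=
    Primrec₂.natPair.comp
      (Primrec.fst.comp (Primrec.snd.comp (Primrec.snd.comp Primrec.snd)))
      (Primrec.snd.comp (Primrec.snd.comp (Primrec.snd.comp Primrec.snd)))
  have h := Nat.Partrec.Code.primrec_recOn (α := Code) (σ := ℕ) Primrec.id (Primrec.const 0)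
    (Primrec.const 1) (Primrec.const 2) (Primrec.const 3)
    (pr := fun _ _ _ a b => 2 * (2 * Nat.pair a b) + 5)
    (co := fun _ _ _ a b => 2 * (2 * Nat.pair a b + 1) + 5)
    (pc := fun _ _ _ a b => (2 * (2 * Nat.pair a b) + 1) + 5)
    (rf := fun _ _ a => (2 * (2 * a + 1) + 1) + 5) ?_ ?_ ?_ ?_
  · refine (h.of_eq fun c => ?_).to_comp
    dsimp only [id]
    induction c <;> simp only [oracleIndex, *]
  · exact Primrec.nat_add.comp (Primrec.nat_double.comp (Primrec.nat_double.comp hpair))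
      (Primrec.const 5)
  · exact Primrec.nat_add.comp (Primrec.nat_double.comp (Primrec.nat_double_succ.comp hpair))
      (Primrec.const 5)
  · exact Primrec.nat_add.comp (Primrec.nat_double_succ.comp (Primrec.nat_double.comp hpair))
      (Primrec.const 5)
  · exact Primrec.nat_add.comp (Primrec.nat_double_succ.comp (Primrec.nat_double_succ.comp
      (Primrec.snd.comp Primrec.snd))) (Primrec.const 5)

theorem phiOracle_oracleIndex (X : ℕ → Bool) (c : Code) :
    phiOracle X (oracleIndex c) = c.eval := by
  unfold phiOracle
  induction c <;>
    simp [oracleIndex, OracleCode.ofIndex, Nat.div2_val, OracleCode.eval, Nat.Partrec.Code.eval,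
      *] <;>
    rfl

/-! ### Membership in deep classes -/

theorem phi_encode (d : Code) : phi (Encodable.encode d) = d.eval := by
  rw [phi, Denumerable.ofNat_encode]

theorem partrec_phi (e : ℕ) : Partrec (phi e) :=
  Partrec.nat_iff.2 (Nat.Partrec.Code.exists_code.2 ⟨_, rfl⟩)

theorem partrec_some : Partrec fun n : ℕ => Part.some n :=
  Computable.id.partrec

theorem exists_isDeepPi01Class_haltingSet :
    ∃ Q : Set (ℕ → Bool), IsDeepPi01Class Q ∧ charSeq haltingSet ∈ Q := by
  refine exists_isDeepPi01Class_of_separating Computable.encode partrec_some Partrec.none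
    (fun d hd => ?_) (fun d hd => ?_) <;>
  simp [haltingSet, phi_encode, hd]

theorem exists_isDeepPi01Class_jump (X : ℕ → Bool) :
    ∃ Q : Set (ℕ → Bool), IsDeepPi01Class Q ∧ charSeq (jump X) ∈ Q := by
  refine exists_isDeepPi01Class_of_separating computable_oracleIndex partrec_some Partrec.none
    (fun d hd => ?_) (fun d hd => ?_) <;>
  simp [jump, phiOracle_oracleIndex, hd]

theorem IsIndexSet.exists_isDeepPi01Class {C : Set ℕ} (hC : IsIndexSet C) (hne : C ≠ ∅)
    (huniv : C ≠ Set.univ) : ∃ Q : Set (ℕ → Bool), IsDeepPi01Class Q ∧ charSeq C ∈ Q := by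
  obtain ⟨a, ha⟩ := Set.nonempty_iff_ne_empty.2 hne
  obtain ⟨b, hb⟩ := (Set.ne_univ_iff_exists_notMem C).1 huniv
  exact exists_isDeepPi01Class_of_separating Computable.encode (partrec_phi a) (partrec_phi b)
    (fun d hd => hC _ _ ((phi_encode d).trans hd).symm ha)
    (fun d hd h => hb (hC _ _ ((phi_encode d).trans hd) h))

end DeepClass

theorem mainTheorem10 :
    (∃ Q : Set (ℕ → Bool), DeepClass.IsDeepPi01Class Q ∧
      DeepClass.charSeq DeepClass.haltingSet ∈ Q) ∧
    (∀ X : ℕ → Bool, ∃ Q : Set (ℕ → Bool), DeepClass.IsDeepPi01Class Q ∧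
      DeepClass.charSeq (DeepClass.jump X) ∈ Q) ∧
    (∀ C : Set ℕ, DeepClass.IsIndexSet C → C ≠ ∅ → C ≠ Set.univ →
      ∃ Q : Set (ℕ → Bool), DeepClass.IsDeepPi01Class Q ∧ DeepClass.charSeq C ∈ Q) :=
  ⟨DeepClass.exists_isDeepPi01Class_haltingSet, DeepClass.exists_isDeepPi01Class_jump,
    fun _ => DeepClass.IsIndexSet.exists_isDeepPi01Class⟩
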